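/- Let $n\ge 1$. A mixed graph on a finite vertex set $V$ is a set $E\subseteq V\times V$ containing no pair $(u,u)$. Its Hermitian adjacency matrix $H=(h_{uv})_{u,v\in V}$ has $h_{uv}=1$ if $(u,v),(v,u)\in E$; $h_{uv}=i$ if $(u,v)\in E$, $(v,u)\notin E$; $h_{uv}=-i$ if $(u,v)\notin E$, $(v,u)\in E$; and $h_{uv}=0$ otherwise. The mixed graph is called integral if all eigenvalues of $H$ are integers. A mixed circulant graph on $n$ vertices is a mixed graph $\mathrm{Circ}(\mathbb{Z}_n,\mathcal{C})$ with vertex set $\mathbb{Z}_n$ and edge set $\{(a,b) : b-a\in\mathcal{C}\}$, where $\mathcal{C}\subseteq\mathbb{Z}_n$ and $0\notin\mathcal{C}$. Let $\tau(m)$ denote the number of positive divisors of $m$. Then the number of integral mixed circulant graphs on $n$ vertices is at most $$k(n)=\begin{cases}2^{\tau(n/4)+\tau(n)-1} & \text{if } n\equiv 0 \pmod 4,\\ 2^{\tau(n)-1} & \text{if } n\not\equiv 0 \pmod 4.\end{cases}$$ The bound holds both for the number of distinct integral mixed graphs $\mathrm{Circ}(\mathbb{Z}_n,\mathcal{C})$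 on the vertex set $\mathbb{Z}_n$ and for the number of their isomorphism classes. -/

import Mathlib

/-- A mixed graph on the vertex type `V`: a set of ordered pairs of distinct vertices.
A pair of vertices related in both directions is an undirected edge, a pair related in exactly one
direction is a directed edge. Simple graphs and oriented graphs are special cases. -/
@[ext]
structure MixedGraph (V : Type*) extends Digraph V where
  loopless : ∀ v, ¬ Adj v v

namespace MixedGraph

open Classical in
/-- The Hermitian adjacency matrix (Liu and Li) of a mixed graph. -/
noncomputable def hermitianAdjMatrix {V : Type*} (G : MixedGraph V) : Matrix V V ℂ :=
  Matrix.of fun u v =>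
    if G.Adj u v ∧ G.Adj v u then 1
    else if G.Adj u v ∧ ¬ G.Adj v u then Complex.I
    else if ¬ G.Adj u v ∧ G.Adj v u then -Complex.I
    else 0

/-- A mixed graph is integral if all eigenvalues of its Hermitian adjacency matrix are integers. -/
def IsIntegral {V : Type*} [Fintype V] [DecidableEq V] (G : MixedGraph V) : Prop :=
  ∀ μ : ℂ, Module.End.HasEigenvalue (Matrix.toLin' G.hermitianAdjMatrix) μ → ∃ k : ℤ, μ = k

/-- The mixed circulant graph `Circ(ℤ_n, C)` with symbol set `C`, where `0 ∉ C`: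
`(a, b)` is an edge iff `b - a ∈ C`. -/
def circ (n : ℕ) (C : Set (ZMod n)) (h0 : (0 : ZMod n) ∉ C) : MixedGraph (ZMod n) where
  Adj a b := b - a ∈ C
  loopless v := by simpa using h0

/-- A mixed graph on `ℤ_n` is a mixed circulant graph if it is `Circ(ℤ_n, C)` for some `C`. -/
def IsCirculant {n : ℕ} (G : MixedGraph (ZMod n)) : Prop :=
  ∃ (C : Set (ZMod n)) (h0 : (0 : ZMod n) ∉ C), G = circ n C h0

/-- Isomorphism of mixed graphs: a bijection of the vertices that preserves and reflects the
ordered pairs in the edge set. -/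
def isoSetoid (V : Type*) : Setoid (MixedGraph V) where
  r G H := Nonempty (G.Adj ≃r H.Adj)
  iseqv :=
    { refl := fun G => ⟨RelIso.refl G.Adj⟩
      symm := fun ⟨e⟩ => ⟨e.symm⟩
      trans := fun ⟨e⟩ ⟨f⟩ => ⟨e.trans f⟩ }

/-- The set of integral mixed circulant graphs on the vertex set `ℤ_n`. -/
def integralCirculant (n : ℕ) [NeZero n] : Set (MixedGraph (ZMod n)) :=
  {G | G.IsCirculant ∧ G.IsIntegral}

/-- The set of isomorphism classes of integral mixed circulant graphs on `n` vertices. -/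
def integralCirculantClasses (n : ℕ) [NeZero n] : Set (Quotient (isoSetoid (ZMod n))) :=
  Quotient.mk (isoSetoid (ZMod n)) '' integralCirculant n

end MixedGraph

namespace MixedGraph

/-! The Fourier coefficients of the first row `f` of `H` are eigenvalues. If they are integers,
Fourier inversion writes `n * f x` as an integer combination of roots of unity, and the conjugation
`ζ ↦ ζ ^ a` of a primitive `4n`-th root with `a ≡ 1 [MOD 4]` fixes `i`, so `f (a * x) = f x`
(`symbol_mul_eq_of_isIntegral`). Hence `C` is a union of orbits of such `a`. Each orbit contains `d`
or `-d` for some `d ∣ n`, and these share an orbit unless `4 ∣ n / d`. One bit per divisor `d ≠ n`,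
plus one per `d` with `4 ∣ n / d`, thus determines `C`. -/

lemma circ_hermitianAdjMatrix_eq_sub {n : ℕ} (C : Set (ZMod n)) (h0 : (0 : ZMod n) ∉ C)
    (u v : ZMod n) :
    (circ n C h0).hermitianAdjMatrix u v = (circ n C h0).hermitianAdjMatrix 0 (v - u) := by
  have h : (circ n C h0).Adj u v ↔ (circ n C h0).Adj 0 (v - u) := by simp [circ]
  have h' : (circ n C h0).Adj v u ↔ (circ n C h0).Adj (v - u) 0 := by simp [circ]
  simp only [hermitianAdjMatrix, Matrix.of_apply]
  split_ifs <;> first | rfl | tauto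

/-- The Fourier coefficients of the symbol of a mixed circulant graph are eigenvalues. -/
lemma hasEigenvalue_dft_circ {n : ℕ} [NeZero n] (C : Set (ZMod n)) (h0 : (0 : ZMod n) ∉ C)
    (j : ZMod n) :
    Module.End.HasEigenvalue (Matrix.toLin' (circ n C h0).hermitianAdjMatrix)
      (ZMod.dft ((circ n C h0).hermitianAdjMatrix 0) j) := by
  refine Module.End.hasEigenvalue_of_hasEigenvector
    (x := fun u => ZMod.stdAddChar (-(u * j))) ⟨?_, fun h => ?_⟩
  · rw [Module.End.mem_eigenspace_iff]
    ext u
    simp only [Matrix.toLin'_apply, Matrix.mulVec, dotProduct, Pi.smul_apply, smul_eq_mul,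
      ZMod.dft_apply, Finset.sum_mul]
    rw [← Equiv.sum_comp (Equiv.addRight u)]
    refine Finset.sum_congr rfl fun x _ => ?_
    rw [circ_hermitianAdjMatrix_eq_sub, Equiv.coe_addRight, add_sub_cancel_right, add_mul, neg_add,
      AddChar.map_add_eq_mul]
    ring
  · simpa using congrFun h 0

/-- Galois conjugation in polynomial form: `ζ` and `ζ ^ a` have the same minimal polynomial over
`ℤ`. -/
lemma aeval_pow_eq_zero_of_isPrimitiveRoot {N a : ℕ} (hN : 0 < N) (ha : a.Coprime N) {ζ : ℂ}
    (hζ : IsPrimitiveRoot ζ N) {P : Polynomial ℤ} (hP : Polynomial.aeval ζ P = 0) :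
    Polynomial.aeval (ζ ^ a) P = 0 := by
  obtain ⟨Q, hQ⟩ := minpoly.isIntegrallyClosed_dvd (hζ.isIntegral hN) hP
  rw [hQ, map_mul, hζ.minpoly_eq_pow_coprime ha, minpoly.aeval, zero_mul]

/-- A single `F` serves both `ζ` and its conjugate `ζ ^ a`. -/
lemma exists_polynomial_aeval_eq_symbol {n : ℕ} (C : Set (ZMod n))
    (h0 : (0 : ZMod n) ∉ C) (x : ZMod n) :
    ∃ F : Polynomial ℤ, ∀ z : ℂ, z ^ n = Complex.I →
      Polynomial.aeval z F = (circ n C h0).hermitianAdjMatrix 0 x := by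
  simp only [hermitianAdjMatrix, Matrix.of_apply]
  split_ifs
  · exact ⟨1, by simp⟩
  · exact ⟨Polynomial.X ^ n, by simp⟩
  · exact ⟨-Polynomial.X ^ n, by simp⟩
  · exact ⟨0, by simp⟩

lemma symbol_mul_eq_of_isIntegral {n : ℕ} [NeZero n] {C : Set (ZMod n)} {h0 : (0 : ZMod n) ∉ C}
    (hG : (circ n C h0).IsIntegral) {a : ℕ} (ha : a.Coprime (4 * n)) (ha4 : a ≡ 1 [MOD 4])
    (x : ZMod n) :
    (circ n C h0).hermitianAdjMatrix 0 (a * x) = (circ n C h0).hermitianAdjMatrix 0 x := by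
  have hn : n ≠ 0 := NeZero.ne n
  have hnC : (n : ℂ) ≠ 0 := Nat.cast_ne_zero.mpr hn
  choose l hl using fun j => hG _ (hasEigenvalue_dft_circ C h0 j)
  obtain ⟨F, hF⟩ := exists_polynomial_aeval_eq_symbol C h0 x
  set f := (circ n C h0).hermitianAdjMatrix 0
  have inv (y : ZMod n) : (n : ℂ) * f y = ∑ j : ZMod n, (l j : ℂ) * ZMod.stdAddChar (j * y) := by
    have h := congrFun (ZMod.dft_dft f) (-y)
    rw [ZMod.dft_apply] at h
    simp only [smul_eq_mul, neg_neg, mul_neg, hl] at h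
    rw [← h]
    exact Finset.sum_congr rfl fun j _ => mul_comm _ _
  have hN : 0 < 4 * n := by positivity
  set ζ : ℂ := Complex.exp (2 * Real.pi * Complex.I / (4 * n : ℕ)) with hζdef
  have hζ : IsPrimitiveRoot ζ (4 * n) := Complex.isPrimitiveRoot_exp _ hN.ne'
  have hζn : ζ ^ n = Complex.I := by
    rw [hζdef, ← Complex.exp_nat_mul]
    refine Eq.trans ?_ Complex.exp_pi_div_two_mul_I
    congr 1
    push_cast
    field_simp
    norm_num
  have hζ4 (y : ZMod n) : ζ ^ (4 * y.val) = ZMod.stdAddChar y := by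
    conv_rhs => rw [← ZMod.natCast_zmod_val y, ← Int.cast_natCast, ZMod.stdAddChar_coe]
    rw [hζdef, ← Complex.exp_nat_mul]
    congr 1
    push_cast
    field_simp
  have hζan : (ζ ^ a) ^ n = Complex.I := by
    rw [pow_right_comm, hζn, Complex.I_pow_eq_pow_mod, ha4, Nat.one_mod, pow_one]
  have hP : Polynomial.aeval ζ (∑ j : ZMod n, Polynomial.C (l j) * Polynomial.X ^ (4 * (j * x).val)
      - (n : Polynomial ℤ) * F) = 0 := by
    simp [hF ζ hζn, hζ4, ← inv x]
  have hPa := aeval_pow_eq_zero_of_isPrimitiveRoot hN ha hζ hP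
  have hpow (j : ZMod n) : (ζ ^ a) ^ (4 * (j * x).val) = ZMod.stdAddChar (j * ((a : ZMod n) * x)) := by
    rw [pow_right_comm, hζ4, ← AddChar.map_nsmul_eq_pow, nsmul_eq_mul, mul_left_comm]
  simp only [map_sub, map_sum, map_mul, map_pow, Polynomial.aeval_X, hpow,
    map_natCast, hF _ hζan, eq_intCast, map_intCast, ← inv] at hPa
  exact mul_left_cancel₀ hnC (sub_eq_zero.mp hPa)

lemma mem_iff_symbol {n : ℕ} {C : Set (ZMod n)} {h0 : (0 : ZMod n) ∉ C} (x : ZMod n) :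
    x ∈ C ↔ (circ n C h0).hermitianAdjMatrix 0 x = 1 ∨
      (circ n C h0).hermitianAdjMatrix 0 x = Complex.I := by
  have h1 : -Complex.I ≠ 1 := fun h => by simpa using congrArg Complex.re h
  have h2 : -Complex.I ≠ Complex.I := fun h => by
    have := congrArg Complex.im h
    norm_num at this
  have h : x ∈ C ↔ (circ n C h0).Adj 0 x := by simp [circ]
  simp only [hermitianAdjMatrix, Matrix.of_apply, h]
  split_ifs <;> simp_all [Complex.I_ne_zero.symm]

/-- The symbol set of an integral mixed circulant graph is invariant under units that are
congruent to `1` modulo `4`. -/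
lemma mul_mem_iff_of_isIntegral {n : ℕ} [NeZero n] {C : Set (ZMod n)} {h0 : (0 : ZMod n) ∉ C}
    (hG : (circ n C h0).IsIntegral) {a : ℕ} (ha : a.Coprime (4 * n)) (ha4 : a ≡ 1 [MOD 4])
    (x : ZMod n) : (a : ZMod n) * x ∈ C ↔ x ∈ C := by
  rw [mem_iff_symbol (h0 := h0), mem_iff_symbol (h0 := h0), symbol_mul_eq_of_isIntegral hG ha ha4]

lemma exists_coprime_modEq {m N k : ℕ} [NeZero N] (hm : m ∣ N) (hk : k.Coprime m) :
    ∃ a : ℕ, a.Coprime N ∧ a ≡ k [MOD m] := by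
  obtain ⟨u, hu⟩ := ZMod.unitsMap_surjective hm (ZMod.unitOfCoprime k hk)
  refine ⟨(u : ZMod N).val, ZMod.val_coe_unit_coprime u, ?_⟩
  rw [← ZMod.natCast_eq_natCast_iff]
  have := congrArg Units.val hu
  rw [ZMod.unitsMap_val, ZMod.coe_unitOfCoprime] at this
  rw [← this, ZMod.natCast_val]

lemma natCast_mul_eq_of_modEq {n d a b : ℕ} (hd : d ∣ n) (h : a ≡ b [MOD n / d]) :
    (a : ZMod n) * d = b * d := by
  have := h.mul_right' d
  rw [Nat.div_mul_cancel hd] at this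
  exact_mod_cast (ZMod.natCast_eq_natCast_iff _ _ _).mpr this

/-- With `d = gcd(x, n)`, the cofactor `x / d` is only coprime to `n / d`; it matters only modulo `n
/ d`, so it can be lifted to a unit modulo `4 * n`. -/
lemma exists_coprime_mul_divisor {n : ℕ} [NeZero n] (x : ZMod n) :
    ∃ d a : ℕ, d ∣ n ∧ a.Coprime (4 * n) ∧ x = a * d := by
  have hn : 0 < n := NeZero.pos n
  have hg : x.val.gcd n ∣ n := Nat.gcd_dvd_right _ _
  obtain ⟨a, ha, hak⟩ := exists_coprime_modEq (N := 4 * n)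
    ((Nat.div_dvd_of_dvd hg).trans (Dvd.intro_left 4 rfl))
    (Nat.coprime_div_gcd_div_gcd (Nat.gcd_pos_of_pos_right x.val hn))
  refine ⟨_, a, hg, ha, ?_⟩
  rw [natCast_mul_eq_of_modEq hg hak, ← Nat.cast_mul, Nat.div_mul_cancel (Nat.gcd_dvd_left _ _),
    ZMod.natCast_zmod_val]

lemma neg_mem_iff_of_not_four_dvd {n : ℕ} [NeZero n] {C : Set (ZMod n)} {h0 : (0 : ZMod n) ∉ C}
    (hG : (circ n C h0).IsIntegral) {d : ℕ} (hd : d ∣ n) (h4 : ¬ 4 ∣ n / d) :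
    -(d : ZMod n) ∈ C ↔ (d : ZMod n) ∈ C := by
  have hn : 0 < n := NeZero.pos n
  set m := n / d with hm
  have hm0 : 0 < m := Nat.div_pos (Nat.le_of_dvd hn hd) (Nat.pos_of_dvd_of_pos hd hn)
  have hmn : m ∣ n := Nat.div_dvd_of_dvd hd
  have hg : Nat.gcd 4 m ∣ 2 := by
    have h1 : Nat.gcd 4 m ∣ 4 := Nat.gcd_dvd_left _ _
    have h2 : Nat.gcd 4 m ∣ m := Nat.gcd_dvd_right _ _
    have h3 : Nat.gcd 4 m ≤ 4 := Nat.le_of_dvd (by norm_num) h1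
    interval_cases h : Nat.gcd 4 m <;> omega
  -- `2 * m - 1` stands for `-1` modulo `m`, without truncation at `m = 1`. As `gcd(4, m) ∣ 2`, some
  -- `b` is `1` modulo `4` and `-1` modulo `m`.
  have hcomp : 1 ≡ 2 * m - 1 [MOD Nat.gcd 4 m] := by
    rw [Nat.modEq_iff_dvd' (by omega)]
    have : 2 * m - 1 - 1 = 2 * (m - 1) := by omega
    rw [this]
    exact hg.mul_right _
  obtain ⟨b, hb4, hbm⟩ := Nat.chineseRemainder' hcomp
  have hbm' : b + 1 ≡ 0 [MOD m] := by
    have := hbm.add_right 1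
    rw [Nat.sub_add_cancel (by omega)] at this
    exact this.trans (Nat.modEq_zero_iff_dvd.mpr (Dvd.intro_left 2 rfl))
  have hcop : b.Coprime (Nat.lcm 4 m) := by
    have h4b : b.Coprime 4 := by
      rw [Nat.Coprime, hb4.gcd_eq]; norm_num
    have hmb : b.Coprime m :=
      ((Nat.coprime_self_add_right (m := b) (n := 1)).mpr
        (Nat.coprime_one_right b)).coprime_dvd_right (Nat.modEq_zero_iff_dvd.mp hbm')
    exact (h4b.mul_right hmb).coprime_dvd_right (Nat.lcm_dvd_mul 4 m)
  obtain ⟨a, ha, hab⟩ := exists_coprime_modEq (N := 4 * n)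
    (Nat.lcm_dvd (Dvd.intro n rfl) (hmn.trans (Dvd.intro_left 4 rfl))) hcop
  have ha4 : a ≡ 1 [MOD 4] := (hab.of_dvd (Nat.dvd_lcm_left 4 m)).trans hb4
  have ham : a + 1 ≡ 0 [MOD m] := ((hab.of_dvd (Nat.dvd_lcm_right 4 m)).add_right 1).trans hbm'
  have had : (a : ZMod n) * d = -d := by
    have := natCast_mul_eq_of_modEq hd ham
    push_cast at this
    linear_combination this
  rw [← had, mul_mem_iff_of_isIntegral hG ha ha4]

/-- The symbol set of an integral mixed circulant graph is determined by the divisors `d` of `n`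
for which it contains `d` or `-d`. -/
lemma mem_iff_mem_of_divisors {n : ℕ} [NeZero n] {C C' : Set (ZMod n)} {h0 : (0 : ZMod n) ∉ C}
    {h0' : (0 : ZMod n) ∉ C'} (hG : (circ n C h0).IsIntegral) (hG' : (circ n C' h0').IsIntegral)
    (h : ∀ d : ℕ, d ∣ n → ((d : ZMod n) ∈ C ↔ (d : ZMod n) ∈ C'))
    (hneg : ∀ d : ℕ, d ∣ n → (-(d : ZMod n) ∈ C ↔ -(d : ZMod n) ∈ C')) (x : ZMod n) :
    x ∈ C ↔ x ∈ C' := by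
  obtain ⟨d, a, hd, ha, rfl⟩ := exists_coprime_mul_divisor x
  have hodd : a.Coprime 2 := (ha.coprime_mul_right_right).coprime_dvd_right (by norm_num)
  rw [Nat.coprime_two_right] at hodd
  rcases Nat.odd_mod_four_iff.mp (Nat.odd_iff.mp hodd) with h4 | h4
  · rw [mul_mem_iff_of_isIntegral hG ha h4, mul_mem_iff_of_isIntegral hG' ha h4, h d hd]
  · have hlt : 0 < 4 * n := Nat.mul_pos (by norm_num) (NeZero.pos n)
    -- Here `a ≡ 3 [MOD 4]`, so `b ≡ -a` is `1` modulo `4` and `a * d = b * -d`.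
    obtain ⟨b, hb, hba⟩ := exists_coprime_modEq (m := 4 * n) (N := 4 * n) dvd_rfl
      (k := (4 * n - 1) * a) ((Nat.Coprime.mul_left
        (Nat.coprime_self_sub_left (by omega) |>.mpr (Nat.coprime_one_left _)) ha))
    have hsum : b + a ≡ 0 [MOD 4 * n] := by
      refine (hba.add_right a).trans ?_
      rw [Nat.modEq_zero_iff_dvd]
      exact ⟨a, by rw [← Nat.succ_mul]; congr 1; omega⟩
    have hb4 : b ≡ 1 [MOD 4] := by
      have := hsum.of_dvd (Dvd.intro n rfl : 4 ∣ 4 * n)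
      unfold Nat.ModEq at this ⊢
      omega
    have hbn : (a : ZMod n) * d = b * -d := by
      have := (ZMod.natCast_eq_natCast_iff _ _ _).mpr
        (hsum.of_dvd (Dvd.intro_left 4 rfl : n ∣ 4 * n))
      push_cast at this
      linear_combination (d : ZMod n) * this
    rw [hbn, mul_mem_iff_of_isIntegral hG hb hb4, mul_mem_iff_of_isIntegral hG' hb hb4, hneg d hd]

open Classical in
lemma encard_integralCirculant_le {n : ℕ} [NeZero n] (D : Finset ℕ)
    (hD : ∀ d, d ∣ n → 4 ∣ n / d → d ∈ D) :
    (integralCirculant n).encard ≤ ((2 ^ (D.card + n.divisors.card - 1) : ℕ) : ℕ∞) := by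
  have hn : n ≠ 0 := NeZero.ne n
  have hself : n ∈ n.divisors := Nat.mem_divisors_self n hn
  let φ : MixedGraph (ZMod n) → Finset ℕ × Finset ℕ := fun G =>
    (D.filter fun d => G.Adj 0 (-(d : ZMod n)), (n.divisors.erase n).filter fun d => G.Adj 0 d)
  have hmaps : Set.MapsTo φ (integralCirculant n)
      (D.powerset ×ˢ (n.divisors.erase n).powerset : Finset (Finset ℕ × Finset ℕ)) := by
    intro G _
    simpa only [φ, Finset.mem_coe, Finset.mem_product, Finset.mem_powerset] using
      ⟨Finset.filter_subset _ _, Finset.filter_subset _ _⟩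
  have hinj : Set.InjOn φ (integralCirculant n) := by
    rintro _ ⟨⟨C, h0, rfl⟩, hG⟩ _ ⟨⟨C', h0', rfl⟩, hG'⟩ heq
    have hpos (d : ℕ) (hd : d ∣ n) : (d : ZMod n) ∈ C ↔ (d : ZMod n) ∈ C' := by
      by_cases hdn : d = n
      -- The divisor `n` represents `0`, which is never in `C`; this saves one bit.
      · simp [hdn, h0, h0']
      · simpa [φ, circ, hd, hdn, hn] using Finset.ext_iff.mp (congrArg Prod.snd heq) d
    have hneg (d : ℕ) (hd : d ∣ n) : -(d : ZMod n) ∈ C ↔ -(d : ZMod n) ∈ C' := by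
      by_cases h4 : 4 ∣ n / d
      · simpa [φ, circ, hD d hd h4] using Finset.ext_iff.mp (congrArg Prod.fst heq) d
      · rw [neg_mem_iff_of_not_four_dvd hG hd h4, neg_mem_iff_of_not_four_dvd hG' hd h4,
          hpos d hd]
    obtain rfl : C = C' := Set.ext (mem_iff_mem_of_divisors hG hG' hpos hneg)
    rfl
  refine (Set.encard_le_encard_of_injOn hmaps hinj).trans_eq ?_
  rw [Set.encard_coe_eq_coe_finsetCard, Finset.card_product, Finset.card_powerset,
    Finset.card_powerset, Finset.card_erase_of_mem hself, ← pow_add,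
    Nat.add_sub_assoc (Finset.card_pos.mpr ⟨n, hself⟩)]

lemma encard_integralCirculantClasses_le (n : ℕ) [NeZero n] :
    (integralCirculantClasses n).encard ≤ (integralCirculant n).encard :=
  Set.encard_image_le _ _

end MixedGraph

theorem corollary5p6 (n : ℕ) [NeZero n] :
    (n ≡ 0 [MOD 4] →
      (MixedGraph.integralCirculant n).encard
          ≤ ((2 ^ ((n / 4).divisors.card + n.divisors.card - 1) : ℕ) : ℕ∞) ∧
      (MixedGraph.integralCirculantClasses n).encard
          ≤ ((2 ^ ((n / 4).divisors.card + n.divisors.card - 1) : ℕ) : ℕ∞)) ∧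
    (¬ n ≡ 0 [MOD 4] →
      (MixedGraph.integralCirculant n).encard
          ≤ ((2 ^ (n.divisors.card - 1) : ℕ) : ℕ∞) ∧
      (MixedGraph.integralCirculantClasses n).encard
          ≤ ((2 ^ (n.divisors.card - 1) : ℕ) : ℕ∞)) := by
  have hn : 0 < n := NeZero.pos n
  refine ⟨fun h4 => ?_, fun h4 => ?_⟩
  · have h4n : 4 ∣ n := Nat.modEq_zero_iff_dvd.mp h4
    have h := MixedGraph.encard_integralCirculant_le (n := n) (n / 4).divisors fun d hd hd4 => by
      obtain ⟨k, hk⟩ := hd4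
      have hnk : n = 4 * (d * k) := by
        rw [← Nat.mul_div_cancel' hd, hk]; ring
      refine Nat.mem_divisors.mpr ⟨⟨k, by omega⟩, ?_⟩
      omega
    exact ⟨h, (MixedGraph.encard_integralCirculantClasses_le n).trans h⟩
  · have h := MixedGraph.encard_integralCirculant_le (n := n) ∅ fun d hd hd4 =>
      absurd (Nat.modEq_zero_iff_dvd.mpr (hd4.trans (Nat.div_dvd_of_dvd hd))) h4
    rw [Finset.card_empty, zero_add] at h
    exact ⟨h, (MixedGraph.encard_integralCirculantClasses_le n).trans h⟩
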